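/- Let $L>0$, let $N$ be a positive integer and let $\alpha\in[0,2\pi)$. Identify $\mathbb R^2$ with $\mathbb C$, put $\mathcal A_\alpha=\{u\in H^1((0,1);\mathbb R^2): u(0)=1,\ u(1)=e^{i\alpha}\}$ with the topology of the $H^1$ norm and, for $\varepsilon>0$ and $u=(u_1,u_2)\in\mathcal A_\alpha$, $$E_\varepsilon(u)=\int_0^1 \frac{\varepsilon}{2}|u'|^2+\frac1{4\varepsilon}(|u|^2-1)^2+\frac L2\,(u_1u_2'-u_2u_1'-2\pi N)^2\,dx .$$ Fix $\rho_0\in(0,1)$. For a nonnegative integer $M$, let $\mathcal U_{\varepsilon,M}$ be the set of all $H^1$-local minimizers $u$ of $E_\varepsilon$ within $\mathcal A_\alpha$ that can be written as $u=\rho e^{i\theta}$ with real-valued $\rho,\theta\in H^1(0,1)$ such that $\rho(0)=\rho(1)=1$, $\rho\ge\rho_0$ on $[0,1]$, $\theta(0)=0$ and $\theta(1)=2\pi M+\alpha$. Let $M_1\ne M_2$ be nonnegative integers and let $h>0$. Put $$\Lambda_h=2\pi^2L\Big(N-M_1-\frac{\alpha}{2\pi}\Big)^2+\frac{2\sqrt2}{3}-h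 .$$ Then there is an $\varepsilon_h>0$ such that for every $\varepsilon\in(0,\varepsilon_h)$, all $u_{\varepsilon,M_1}\in\mathcal U_{\varepsilon,M_1}$ and $u_{\varepsilon,M_2}\in\mathcal U_{\varepsilon,M_2}$, and every continuous path $\gamma:[0,1]\to\mathcal A_\alpha$ with $\gamma(0)=u_{\varepsilon,M_1}$ and $\gamma(1)=u_{\varepsilon,M_2}$, the path leaves the sublevel set $\{u\in\mathcal A_\alpha: E_\varepsilon(u)<\Lambda_h\}$: there is a $t\in[0,1]$ with $E_\varepsilon(\gamma(t))\ge\Lambda_h$. -/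

import Mathlib

open MeasureTheory Set
open scoped ContDiff

noncomputable section

namespace Cholesteric

/-- Lebesgue measure on the interval `(0,1)`. -/
abbrev μI : Measure ℝ := volume.restrict (Ioo (0 : ℝ) 1)

/-- Pairs `(u, g)` of (classes of) functions in `L²((0,1); F)`. The first entry is the function, the
second one is meant to be its weak derivative. -/
abbrev L2Pair (F : Type) [NormedAddCommGroup F] : Type :=
  Lp F 2 μI × Lp F 2 μI

/-- `g` is the weak derivative of `u` on `(0,1)`: `∫ φ' u = - ∫ φ g` for every test function
`φ ∈ C_c^∞((0,1))`. -/
def IsWeakDeriv {F : Type} [NormedAddCommGroup F] [NormedSpace ℝ F] (u g : Lp F 2 μI) : Prop :=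
  ∀ φ : ℝ → ℝ, ContDiff ℝ ∞ φ → HasCompactSupport φ → tsupport φ ⊆ Ioo (0 : ℝ) 1 →
    ∫ x, deriv φ x • u x ∂μI = - ∫ x, φ x • g x ∂μI

/-- The Sobolev space `H¹((0,1); F)`, as the graph of the weak derivative in `L² × L²`. The weak
derivative is unique, so an element `(u, u')` is the same thing as the function `u`, and the topology
induced by `L² × L²` is the topology of the `H¹` norm `(‖u‖² + ‖u'‖²)^{1/2}`. -/
def H1 (F : Type) [NormedAddCommGroup F] [NormedSpace ℝ F] : Set (L2Pair F) :=
  {p | IsWeakDeriv p.1 p.2}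

/-- The boundary values of `u` at `0` and `1`, read off from its continuous representative on `[0,1]`,
are `a` and `b`. -/
def HasBoundaryValues {F : Type} [NormedAddCommGroup F] (u : Lp F 2 μI) (a b : F) : Prop :=
  ∃ v : ℝ → F, ContinuousOn v (Icc 0 1) ∧ u =ᵐ[μI] v ∧ v 0 = a ∧ v 1 = b

/-- The admissible class `𝒜_α` of all `u ∈ H¹((0,1); ℝ²)`, with `ℝ² = ℂ`, such that `u(0) = 1` and
`u(1) = e^{iα}`. -/
def Admissible (α : ℝ) : Set (L2Pair ℂ) :=
  {p | p ∈ H1 ℂ ∧ HasBoundaryValues p.1 1 (Complex.exp (α * Complex.I))}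

/-- The energy
`E_ε(u) = ∫₀¹ ε/2 |u'|² + 1/(4ε) (|u|² - 1)² + L/2 (u₁ u₂' - u₂ u₁' - 2πN)² dx`. -/
def energy (L : ℝ) (N : ℕ) (ε : ℝ) (p : L2Pair ℂ) : ℝ :=
  ∫ x, (ε / 2 * ‖p.2 x‖ ^ 2 + 1 / (4 * ε) * (‖p.1 x‖ ^ 2 - 1) ^ 2
    + L / 2 * ((p.1 x).re * (p.2 x).im - (p.1 x).im * (p.2 x).re - 2 * Real.pi * N) ^ 2) ∂μI

/-- The energy sublevel set `E_ε^Λ = {u ∈ 𝒜_α : E_ε(u) < Λ}`. -/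
def sublevel (L : ℝ) (N : ℕ) (α ε Λ : ℝ) : Set (L2Pair ℂ) :=
  {p | p ∈ Admissible α ∧ energy L N ε p < Λ}

/-- Moduli: `ρ ∈ H¹(0,1)` with `ρ(0) = 1 = ρ(1)` and `ρ ≥ ρ₀` on `(0,1)`. -/
def ModulusClass (ρ₀ : ℝ) : Set (L2Pair ℝ) :=
  {p | p ∈ H1 ℝ ∧ HasBoundaryValues p.1 1 1 ∧ ∀ᵐ x ∂μI, ρ₀ ≤ p.1 x}

/-- Phases: `θ ∈ H¹(0,1)` with `θ(0) = 0` and `θ(1) = 2πM + α`. -/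
def PhaseClass (M : ℕ) (α : ℝ) : Set (L2Pair ℝ) :=
  {p | p ∈ H1 ℝ ∧ HasBoundaryValues p.1 0 (2 * Real.pi * M + α)}

/-- `p` is an `H¹`-local minimizer of `E_ε` within `𝒜_α` that has the global polar form `ρ e^{iθ}`
with `ρ ≥ ρ₀` and with total twist `2πM + α`. -/
structure IsTwistLocalMin (L : ℝ) (N : ℕ) (α ρ₀ ε : ℝ) (M : ℕ) (p : L2Pair ℂ) : Prop where
  mem : p ∈ Admissible α
  isLocalMin : IsLocalMinOn (energy L N ε) (Admissible α) p
  polar : ∃ ρ ∈ ModulusClass ρ₀, ∃ θ ∈ PhaseClass M α,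
    ∀ᵐ x ∂μI, p.1 x = (ρ.1 x : ℂ) * Complex.exp ((θ.1 x : ℂ) * Complex.I)

end Cholesteric

end

/-! ### Vector-valued absolutely continuous functions. -/

section AbsolutelyContinuous

variable {E F : Type*} [NormedAddCommGroup E] [NormedSpace ℝ E]
  [NormedAddCommGroup F] [NormedSpace ℝ F] {a b : ℝ}

/-! On zero-free admissible functions the total phase, the imaginary part of `logLift p 1`, is
locally constant, because the `H¹` distance controls the sup distance (`logLift_one_eq`). A path
between different twists therefore cannot keep its modulus bounded away from zero. Fix a small `η <
ρ₀`: by connectedness, at some time the minimal modulus is exactly `η` while the phase is still `Φ =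
2πM₁ + α` (`exists_norm_prim_eq`). Stopping at `η` rather than at a zero keeps the phase defined.

At that time two costs add up. The modulus goes from `1` to `η` and back, which by the
Modica–Mortola inequality costs at least `2√2/3 - √2 η` (`le_integral_wellDensity`). If the energy
is bounded, the mean of the current differs from `Φ` by `O(√ε)` for fixed `η`, so by Jensen the
twist term is at least `L/2 (Φ - 2πN)² - O(√ε)`. Choosing `η` from `h`, and then `ε`, makes the two
losses at most `h` together (`exists_lt_energy`). -/

theorem AbsolutelyContinuousOnInterval.of_dist_le {X Y : Type*} [PseudoMetricSpace X]
    [PseudoMetricSpace Y] {f : ℝ → X} {g : ℝ → Y} {K : ℝ}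
    (hf : AbsolutelyContinuousOnInterval f a b)
    (h : ∀ x ∈ uIcc a b, ∀ y ∈ uIcc a b, dist (g x) (g y) ≤ K * dist (f x) (f y)) :
    AbsolutelyContinuousOnInterval g a b := by
  have h0 := Filter.Tendsto.const_mul K hf
  rw [mul_zero] at h0
  refine squeeze_zero' (.of_forall fun _ ↦ Finset.sum_nonneg fun _ _ ↦ dist_nonneg) ?_ h0
  have : ∀ᶠ E : ℕ × (ℕ → ℝ × ℝ) in AbsolutelyContinuousOnInterval.totalLengthFilter ⊓
      Filter.principal (AbsolutelyContinuousOnInterval.disjWithin a b),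
      E ∈ AbsolutelyContinuousOnInterval.disjWithin a b :=
    Filter.eventually_inf_principal.mpr (by simp)
  filter_upwards [this] with P hP
  rw [Finset.mul_sum]
  exact Finset.sum_le_sum fun i hi ↦ h _ (hP.1 i hi).1 _ (hP.1 i hi).2

theorem AbsolutelyContinuousOnInterval.comp_contDiffOn {f : ℝ → E} {Φ : E → F} {s : Set E}
    (hf : AbsolutelyContinuousOnInterval f a b) (hΦ : ContDiffOn ℝ 1 Φ s)
    (hs : Convex ℝ s) (hc : IsCompact s) (hm : MapsTo f (uIcc a b) s) :
    AbsolutelyContinuousOnInterval (fun x ↦ Φ (f x)) a b := by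
  obtain ⟨K, hK⟩ := hΦ.exists_lipschitzOnWith (by decide) hs hc
  exact hf.of_dist_le fun x hx y hy ↦ hK.dist_le_mul _ (hm hx) _ (hm hy)

theorem AbsolutelyContinuousOnInterval.comp_contDiff [FiniteDimensional ℝ E] {f : ℝ → E}
    {Φ : E → F} (hf : AbsolutelyContinuousOnInterval f a b) (hΦ : ContDiff ℝ 1 Φ) :
    AbsolutelyContinuousOnInterval (fun x ↦ Φ (f x)) a b := by
  have : ProperSpace E := FiniteDimensional.proper ℝ E
  obtain ⟨C, hC⟩ := hf.exists_bound
  refine hf.comp_contDiffOn (s := Metric.closedBall 0 C) hΦ.contDiffOn (convex_closedBall _ _)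
    (isCompact_closedBall _ _) fun x hx ↦ ?_
  simpa using hC x hx

/-- Increments of the primitive are dominated by those of the real primitive of `‖f‖`. -/
theorem IntervalIntegrable.absolutelyContinuousOnInterval_primitive {f : ℝ → E} {c : ℝ}
    (hf : IntervalIntegrable f volume a b) (hc : c ∈ uIcc a b) :
    AbsolutelyContinuousOnInterval (fun x ↦ ∫ t in c..x, f t) a b := by
  refine (hf.norm.absolutelyContinuousOnInterval_intervalIntegral hc).of_dist_le (K := 1) ?_
  intro x hx y hy
  have key : ∀ z ∈ uIcc a b, IntervalIntegrable f volume c z := fun z hz ↦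
    hf.mono_set (uIcc_subset_uIcc hc hz)
  rw [one_mul, dist_eq_norm, dist_eq_norm, intervalIntegral.integral_interval_sub_left (key x hx)
    (key y hy), intervalIntegral.integral_interval_sub_left (key x hx).norm (key y hy).norm]
  exact intervalIntegral.norm_integral_le_abs_integral_norm

/-- Subtracting the primitive of `f'` leaves an absolutely continuous function with a.e. zero
derivative, hence a constant. -/
theorem AbsolutelyContinuousOnInterval.integral_eq_sub [CompleteSpace E] {f f' : ℝ → E}
    (hf : AbsolutelyContinuousOnInterval f a b)
    (hd : ∀ᵐ x, x ∈ uIcc a b → HasDerivAt f (f' x) x)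
    (hi : IntervalIntegrable f' volume a b) : ∫ x in a..b, f' x = f b - f a := by
  have hac := hf.fun_sub (hi.absolutelyContinuousOnInterval_primitive (c := a) left_mem_uIcc)
  obtain ⟨C, hC⟩ := hac.const_of_ae_hasDerivAt_zero (by
    filter_upwards [hd, hi.ae_hasDerivAt_integral] with x h1 h2 hx
    have h3 := (h1 hx).fun_sub (h2 hx a left_mem_uIcc)
    rwa [sub_self] at h3)
  have h1 := hC a left_mem_uIcc
  have h2 := hC b right_mem_uIcc
  simp only [intervalIntegral.integral_same, sub_zero] at h1
  rw [h1, ← h2]; abel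

end AbsolutelyContinuous

/-- A continuous function on an interval with `exp ∘ f = 1` is constant. -/
theorem Complex.eq_of_exp_eq_one {f : ℝ → ℂ} {s : Set ℝ} (hs : IsPreconnected s)
    (hf : ContinuousOn f s) (h1 : ∀ x ∈ s, Complex.exp (f x) = 1) {x y : ℝ} (hx : x ∈ s)
    (hy : y ∈ s) : f x = f y := by
  have hint : ∀ z ∈ s, ∃ n : ℤ, f z = n * (2 * Real.pi * Complex.I) := fun z hz ↦
    Complex.exp_eq_one_iff.mp (h1 z hz)
  have hT : IsDiscrete (range ((↑) : ℤ → ℝ)) := by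
    exact Int.isClosedEmbedding_coe_real.isEmbedding.isDiscrete_range
  have hg : ContinuousOn (fun z ↦ (f z).im / (2 * Real.pi)) s :=
    (Complex.continuous_im.comp_continuousOn hf).div_const _
  have hval : ∀ z ∈ s, ∀ n : ℤ, f z = n * (2 * Real.pi * Complex.I) →
      (f z).im / (2 * Real.pi) = n := by
    intro z _ n hn
    rw [hn]
    have : (2 * Real.pi : ℝ) ≠ 0 := by positivity
    simp [this]
  have := hs.constant_of_mapsTo hT hg (fun z hz ↦ by
    obtain ⟨n, hn⟩ := hint z hz
    exact ⟨n, (hval z hz n hn).symm⟩) hx hy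
  obtain ⟨n, hn⟩ := hint x hx
  obtain ⟨m, hm⟩ := hint y hy
  rw [hval x hx n hn, hval y hy m hm] at this
  rw [hn, hm, Int.cast_injective this]

/-! ### `H¹` functions on `(0,1)` as primitives of their weak derivatives. -/

namespace Cholesteric

theorem integral_μI {E : Type*} [NormedAddCommGroup E] [NormedSpace ℝ E] (f : ℝ → E) :
    ∫ x, f x ∂μI = ∫ x in (0 : ℝ)..1, f x := by
  rw [intervalIntegral.integral_of_le zero_le_one, integral_Ioc_eq_integral_Ioo]

theorem intervalIntegrable_iff_μI {E : Type*} [NormedAddCommGroup E] {f : ℝ → E} :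
    IntervalIntegrable f volume 0 1 ↔ Integrable f μI :=
  intervalIntegrable_iff_integrableOn_Ioo_of_le zero_le_one

theorem uIcc_subset_unit {x : ℝ} (hx : x ∈ Icc (0 : ℝ) 1) : uIcc 0 x ⊆ uIcc (0 : ℝ) 1 :=
  uIcc_subset_uIcc left_mem_uIcc (by rwa [uIcc_of_le zero_le_one])

theorem eqOn_of_ae_eq_μI {E : Type*} [TopologicalSpace E] [T2Space E] {f g : ℝ → E}
    (h : f =ᵐ[μI] g) (hf : ContinuousOn f (Icc 0 1)) (hg : ContinuousOn g (Icc 0 1)) :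
    EqOn f g (Icc 0 1) :=
  Measure.eqOn_Icc_of_ae_eq volume zero_ne_one
    (by rwa [← Measure.restrict_congr_set Ioo_ae_eq_Icc]) hf hg

/-- A smooth function with compact support in `(0,1)` and mean zero is the derivative of a test
function. -/
theorem exists_test_primitive {w : ℝ → ℝ} (hw : ContDiff ℝ ∞ w) (hc : HasCompactSupport w)
    (hs : tsupport w ⊆ Ioo 0 1) (h0 : ∫ x in (0 : ℝ)..1, w x = 0) :
    ∃ φ : ℝ → ℝ, ContDiff ℝ ∞ φ ∧ HasCompactSupport φ ∧ tsupport φ ⊆ Ioo 0 1 ∧ deriv φ = w := by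
  obtain ⟨a, b, ha, hb, hab⟩ : ∃ a b : ℝ, 0 < a ∧ b < 1 ∧ tsupport w ⊆ Icc a b := by
    rcases (tsupport w).eq_empty_or_nonempty with he | hne
    · exact ⟨1 / 2, 1 / 2, by norm_num, by norm_num, by simp [he]⟩
    · obtain ⟨a, ha⟩ := hc.isCompact.exists_isLeast hne
      obtain ⟨b, hb⟩ := hc.isCompact.exists_isGreatest hne
      exact ⟨a, b, (hs ha.1).1, (hs hb.1).2, fun x hx ↦ ⟨ha.2 hx, hb.2 hx⟩⟩
  have hz : ∀ x, x ∉ Icc a b → w x = 0 := fun x hx ↦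
    image_eq_zero_of_notMem_tsupport fun h ↦ hx (hab h)
  have hder : ∀ x, HasDerivAt (fun y ↦ ∫ t in (0 : ℝ)..y, w t) (w x) x := fun x ↦
    intervalIntegral.integral_hasDerivAt_right (hw.continuous.intervalIntegrable _ _)
      (hw.continuous.stronglyMeasurableAtFilter _ _) hw.continuous.continuousAt
  have hd : deriv (fun y ↦ ∫ t in (0 : ℝ)..y, w t) = w := funext fun x ↦ (hder x).deriv
  have hsupp : Function.support (fun y ↦ ∫ t in (0 : ℝ)..y, w t) ⊆ Icc a b := by
    intro x hx
    by_contra hxab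
    apply hx
    rw [mem_Icc, not_and_or, not_le, not_le] at hxab
    have hzero : ∀ p q : ℝ, (∀ t ∈ uIcc p q, t ∉ Icc a b) → ∫ t in p..q, w t = 0 := by
      intro p q hpq
      rw [intervalIntegral.integral_congr (g := fun _ ↦ 0) fun t ht ↦ hz t (hpq t ht)]
      simp
    rcases hxab with h | h
    · refine hzero _ _ fun t ht hta ↦ ?_
      have := ht.2.trans (max_le ha.le h.le : max 0 x ≤ a)
      rcases le_max_iff.mp ht.2 with h' | h' <;> linarith [hta.1]
    -- To the right of `b`, mean zero is what makes the primitive vanish: nothing is left to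
    -- integrate on `[x,1]`.
    · have : ∫ t in x..1, w t = 0 := by
        refine hzero _ _ fun t ht hta ↦ ?_
        rcases min_le_iff.mp ht.1 with h' | h' <;> linarith [hta.2]
      rw [← intervalIntegral.integral_add_adjacent_intervals
        (hw.continuous.intervalIntegrable 0 x) (hw.continuous.intervalIntegrable x 1), this,
        add_zero] at h0
      exact h0
  have hts : tsupport (fun y ↦ ∫ t in (0 : ℝ)..y, w t) ⊆ Icc a b :=
    closure_minimal hsupp isClosed_Icc
  refine ⟨_, ?_, HasCompactSupport.of_support_subset_isCompact isCompact_Icc hsupp,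
    hts.trans fun x hx ↦ ⟨ha.trans_le hx.1, hx.2.trans_lt hb⟩, hd⟩
  rw [contDiff_infty_iff_deriv, hd]
  exact ⟨fun x ↦ (hder x).differentiableAt, hw⟩

theorem integrable_smul_of_hasCompactSupport {E : Type*} [NormedAddCommGroup E] [NormedSpace ℝ E]
    {w : ℝ → ℝ} (hw : Continuous w) (hc : HasCompactSupport w) {g : ℝ → E}
    (hg : Integrable g μI) : Integrable (fun x ↦ w x • g x) μI := by
  obtain ⟨C, hC⟩ := hw.bounded_above_of_compact_support hc
  exact hg.bdd_smul C hw.aestronglyMeasurable (.of_forall hC)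

/-- The lemma of du Bois-Reymond on `(0,1)`. -/
theorem exists_ae_eq_const {E : Type*} [NormedAddCommGroup E] [NormedSpace ℝ E] [CompleteSpace E]
    {f : ℝ → E} (hf : Integrable f μI)
    (h : ∀ φ : ℝ → ℝ, ContDiff ℝ ∞ φ → HasCompactSupport φ → tsupport φ ⊆ Ioo (0 : ℝ) 1 →
      ∫ x, deriv φ x • f x ∂μI = 0) : ∃ c : E, ∀ᵐ x ∂μI, f x = c := by
  let β : ContDiffBump (1 / 2 : ℝ) := ⟨1 / 4, 3 / 8, by norm_num, by norm_num⟩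
  let ψ : ℝ → ℝ := β.normed volume
  have hψ : ContDiff ℝ ∞ ψ := β.contDiff_normed
  have hψc : HasCompactSupport ψ := β.hasCompactSupport_normed
  have hψs : tsupport ψ ⊆ Ioo 0 1 := by
    rw [β.tsupport_normed_eq, Real.closedBall_eq_Icc]
    intro x hx
    have h1 : (1 / 2 - 3 / 8 : ℝ) ≤ x := hx.1
    have h2 : x ≤ (1 / 2 + 3 / 8 : ℝ) := hx.2
    constructor <;> linarith
  have hint : ∀ w : ℝ → ℝ, tsupport w ⊆ Ioo 0 1 → ∫ x in (0 : ℝ)..1, w x = ∫ x, w x := by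
    intro w hw
    rw [← integral_μI]
    exact setIntegral_eq_integral_of_forall_compl_eq_zero fun x hx ↦
      image_eq_zero_of_notMem_tsupport fun h ↦ hx (hw h)
  have hψ1 : ∫ x in (0 : ℝ)..1, ψ x = 1 := by rw [hint ψ hψs]; exact β.integral_normed
  refine ⟨∫ x, ψ x • f x ∂μI, ?_⟩
  set c := ∫ x, ψ x • f x ∂μI with hcdef
  have hfc : Integrable (fun x ↦ f x - c) μI := hf.sub (integrable_const c)
  have hae := isOpen_Ioo.ae_eq_zero_of_integral_contDiff_smul_eq_zero (U := Ioo (0 : ℝ) 1)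
    (f := fun x ↦ f x - c) (μ := volume) (IntegrableOn.locallyIntegrableOn hfc) (by
    intro w hw hwc hws
    have hsplit : ∫ x, w x • (f x - c) = ∫ x, w x • (f x - c) ∂μI := by
      refine (setIntegral_eq_integral_of_forall_compl_eq_zero fun x hx ↦ ?_).symm
      rw [image_eq_zero_of_notMem_tsupport fun h ↦ hx (hws h), zero_smul]
    have hwint : Integrable w μI := (hw.continuous.integrable_of_hasCompactSupport hwc).restrict
    set m := ∫ x, w x ∂μI with hm
    have hsub : tsupport (fun x ↦ w x - m * ψ x) ⊆ tsupport w ∪ tsupport ψ := by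
      refine closure_minimal ?_ ((isClosed_tsupport _).union (isClosed_tsupport _))
      intro x hx
      by_contra hx'
      rw [mem_union, not_or] at hx'
      apply hx
      simp [image_eq_zero_of_notMem_tsupport hx'.1, image_eq_zero_of_notMem_tsupport hx'.2]
    -- Since `ψ` has unit mass, `w - mψ` has mean zero and is a derivative `φ'`. The hypothesis then
    -- reads `∫ w f = m c`, that is, `f - c` is orthogonal to every `w`.
    obtain ⟨φ, h1, h2, h3, h4⟩ := exists_test_primitive (w := fun x ↦ w x - m * ψ x)
      (hw.sub (contDiff_const.mul hψ))
      (HasCompactSupport.of_support_subset_isCompact (hwc.isCompact.union hψc.isCompact)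
        ((subset_tsupport _).trans hsub))
      (hsub.trans (union_subset hws hψs)) (by
        rw [intervalIntegral.integral_sub (hw.continuous.intervalIntegrable _ _)
          ((hψ.continuous.intervalIntegrable _ _).const_mul m),
          intervalIntegral.integral_const_mul, hψ1, hm, integral_μI]
        ring)
    have h5 := h φ h1 h2 h3
    rw [h4] at h5
    have h6 : ∀ x, (w x - m * ψ x) • f x = w x • f x - m • (ψ x • f x) := fun x ↦ by
      rw [sub_smul, mul_smul]
    simp only [h6] at h5
    rw [integral_sub (integrable_smul_of_hasCompactSupport hw.continuous hwc hf) ((integrable_smul_of_hasCompactSupport hψ.continuous hψc hf).fun_smul m), integral_smul,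
      ← hcdef] at h5
    rw [hsplit]
    simp only [smul_sub]
    rw [integral_sub (integrable_smul_of_hasCompactSupport hw.continuous hwc hf) (hwint.smul_const c), integral_smul_const, ← hm, h5])
  rw [ae_restrict_iff' measurableSet_Ioo]
  filter_upwards [hae] with x hx hx'
  exact sub_eq_zero.mp (hx hx')

theorem integrable_coe_Lp {F : Type} [NormedAddCommGroup F] (g : Lp F 2 μI) :
    Integrable g μI :=
  (Lp.memLp g).integrable one_le_two

theorem intervalIntegrable_coe_Lp {F : Type} [NormedAddCommGroup F] (g : Lp F 2 μI) :
    IntervalIntegrable g volume 0 1 :=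
  intervalIntegrable_iff_μI.mpr (integrable_coe_Lp g)

section Primitive

variable {F : Type} [NormedAddCommGroup F] [NormedSpace ℝ F] [CompleteSpace F]

/-- The primitive of `g` vanishing at `0` is a function with weak derivative `g`. -/
theorem integral_deriv_smul_primitive {g : ℝ → F} (hg : IntervalIntegrable g volume 0 1)
    {φ : ℝ → ℝ} (hφ : ContDiff ℝ ∞ φ) (hs : tsupport φ ⊆ Ioo 0 1) :
    ∫ x, deriv φ x • (∫ t in (0 : ℝ)..x, g t) ∂μI = - ∫ x, φ x • g x ∂μI := by
  have hG := hg.absolutelyContinuousOnInterval_primitive (c := 0) left_mem_uIcc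
  have hφ1 : AbsolutelyContinuousOnInterval φ 0 1 :=
    (hφ.of_le (by exact_mod_cast le_top)).contDiffOn.absolutelyContinuousOnInterval
  have hi1 : IntervalIntegrable (fun x ↦ φ x • g x) volume 0 1 :=
    hg.continuousOn_smul hφ.continuous.continuousOn
  have hi2 : IntervalIntegrable (fun x ↦ deriv φ x • (∫ t in (0 : ℝ)..x, g t)) volume 0 1 :=
    (((hφ.continuous_deriv (by simp)).continuousOn).smul hG.continuousOn).intervalIntegrable
  have := (hφ1.fun_smul hG).integral_eq_sub
    (f' := fun x ↦ φ x • g x + deriv φ x • ∫ t in (0 : ℝ)..x, g t) (by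
      filter_upwards [hg.ae_hasDerivAt_integral] with x h hx
      exact ((hφ.differentiable (by simp)) x).hasDerivAt.smul (h hx 0 left_mem_uIcc))
    (hi1.add hi2)
  rw [intervalIntegral.integral_add hi1 hi2, intervalIntegral.integral_same, smul_zero, sub_zero,
    image_eq_zero_of_notMem_tsupport (x := (1 : ℝ)) fun h ↦ (lt_irrefl _ (hs h).2), zero_smul]
    at this
  rw [integral_μI, integral_μI]
  exact eq_neg_of_add_eq_zero_right this

/-- An `H¹` function with boundary values `a`, `b` is the primitive of its weak derivative. -/
theorem HasBoundaryValues.eq_primitive {p : L2Pair F} (hp : p ∈ H1 F) {a b : F}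
    (hb : HasBoundaryValues p.1 a b) :
    (∀ᵐ x ∂μI, p.1 x = a + ∫ t in (0 : ℝ)..x, p.2 t) ∧ a + ∫ t in (0 : ℝ)..1, p.2 t = b := by
  have hg := intervalIntegrable_coe_Lp p.2
  have hG := hg.absolutelyContinuousOnInterval_primitive (c := 0) left_mem_uIcc
  have hGc : ContinuousOn (fun x ↦ ∫ t in (0 : ℝ)..x, p.2 t) (Icc 0 1) := by
    simpa [uIcc_of_le] using hG.continuousOn
  have hGi : Integrable (fun x ↦ ∫ t in (0 : ℝ)..x, p.2 t) μI :=
    intervalIntegrable_iff_μI.mp hG.continuousOn.intervalIntegrable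
  obtain ⟨c, hc⟩ := exists_ae_eq_const ((integrable_coe_Lp p.1).sub hGi) (by
    intro φ h1 h2 h3
    have hd := h1.continuous_deriv (by simp)
    simp only [Pi.sub_apply, smul_sub]
    rw [integral_sub (integrable_smul_of_hasCompactSupport hd h2.deriv (integrable_coe_Lp p.1))
      (integrable_smul_of_hasCompactSupport hd h2.deriv hGi), hp φ h1 h2 h3,
      integral_deriv_smul_primitive hg h1 h3, sub_self])
  obtain ⟨v, hv, hpv, hv0, hv1⟩ := hb
  -- Two continuous representatives agree on all of `[0,1]`, so evaluating at `0` identifies the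
  -- constant `c` with `a`.
  have heq := eqOn_of_ae_eq_μI (f := v) (g := fun x ↦ c + ∫ t in (0 : ℝ)..x, p.2 t) (by
    filter_upwards [hc, hpv] with x h1 h2
    rw [← h2, ← h1]; simp) hv (continuousOn_const.add hGc)
  have h0 := heq (left_mem_Icc.mpr zero_le_one)
  have h1 := heq (right_mem_Icc.mpr zero_le_one)
  simp only [intervalIntegral.integral_same, add_zero] at h0
  rw [← hv0, ← hv1, h0, h1]
  refine ⟨?_, rfl⟩
  filter_upwards [hc] with x h1
  rw [← h1]; simp

end Primitive

end Cholesteric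

/-! ### Continuous logarithm and total phase. -/

noncomputable section

namespace Cholesteric

instance : IsProbabilityMeasure μI := ⟨by simp⟩

/-- The continuous representative of `p.1` for an admissible `p`. -/
def prim (p : L2Pair ℂ) (x : ℝ) : ℂ := 1 + ∫ t in (0 : ℝ)..x, p.2 t

/-- The continuous logarithm of `prim p` vanishing at `0`, provided that `prim p` has no zeros. -/
def logLift (p : L2Pair ℂ) (x : ℝ) : ℂ := ∫ t in (0 : ℝ)..x, p.2 t * (prim p t)⁻¹

variable {p q : L2Pair ℂ} {α : ℝ}

@[simp] theorem prim_zero : prim p 0 = 1 := by simp [prim]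

@[simp] theorem logLift_zero : logLift p 0 = 0 := by simp [logLift]

theorem absolutelyContinuous_prim : AbsolutelyContinuousOnInterval (prim p) 0 1 :=
  ((contDiff_const (c := (1 : ℂ))).contDiffOn.absolutelyContinuousOnInterval).fun_add
    ((intervalIntegrable_coe_Lp p.2).absolutelyContinuousOnInterval_primitive left_mem_uIcc)

theorem continuousOn_prim : ContinuousOn (prim p) (Icc 0 1) := by
  simpa [uIcc_of_le] using (absolutelyContinuous_prim (p := p)).continuousOn

theorem ae_hasDerivAt_prim : ∀ᵐ x, x ∈ uIcc (0 : ℝ) 1 → HasDerivAt (prim p) (p.2 x) x := by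
  filter_upwards [(intervalIntegrable_coe_Lp p.2).ae_hasDerivAt_integral] with x h hx
  exact (h hx 0 left_mem_uIcc).const_add 1

theorem Admissible.ae_eq_prim (hp : p ∈ Admissible α) : ∀ᵐ x ∂μI, p.1 x = prim p x :=
  (hp.2.eq_primitive hp.1).1

theorem Admissible.prim_one (hp : p ∈ Admissible α) : prim p 1 = Complex.exp (α * Complex.I) :=
  (hp.2.eq_primitive hp.1).2

theorem intervalIntegrable_logDeriv (h0 : ∀ x ∈ Icc (0 : ℝ) 1, prim p x ≠ 0) :
    IntervalIntegrable (fun t ↦ p.2 t * (prim p t)⁻¹) volume 0 1 := by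
  rw [← uIcc_of_le zero_le_one] at h0
  exact (intervalIntegrable_coe_Lp p.2).mul_continuousOn
    (absolutelyContinuous_prim.continuousOn.inv₀ h0)

theorem absolutelyContinuous_logLift (h0 : ∀ x ∈ Icc (0 : ℝ) 1, prim p x ≠ 0) :
    AbsolutelyContinuousOnInterval (logLift p) 0 1 :=
  (intervalIntegrable_logDeriv h0).absolutelyContinuousOnInterval_primitive left_mem_uIcc

theorem continuousOn_logLift (h0 : ∀ x ∈ Icc (0 : ℝ) 1, prim p x ≠ 0) :
    ContinuousOn (logLift p) (Icc 0 1) := by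
  simpa [uIcc_of_le] using (absolutelyContinuous_logLift h0).continuousOn

theorem ae_hasDerivAt_logLift (h0 : ∀ x ∈ Icc (0 : ℝ) 1, prim p x ≠ 0) :
    ∀ᵐ x, x ∈ uIcc (0 : ℝ) 1 → HasDerivAt (logLift p) (p.2 x * (prim p x)⁻¹) x := by
  filter_upwards [(intervalIntegrable_logDeriv h0).ae_hasDerivAt_integral] with x h hx
  exact h hx 0 left_mem_uIcc

/-- The product `exp (-logLift p) * prim p` is absolutely continuous with a.e. zero derivative and
equals `1` at `0`. -/
theorem exp_logLift (h0 : ∀ x ∈ Icc (0 : ℝ) 1, prim p x ≠ 0) {x : ℝ} (hx : x ∈ Icc (0 : ℝ) 1) :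
    Complex.exp (logLift p x) = prim p x := by
  have hexp : ContDiff ℝ 1 fun z : ℂ ↦ Complex.exp (-z) := contDiff_neg.cexp
  have hac := ((absolutelyContinuous_logLift h0).comp_contDiff hexp).fun_smul
    (absolutelyContinuous_prim (p := p))
  obtain ⟨C, hC⟩ := hac.const_of_ae_hasDerivAt_zero (by
    filter_upwards [ae_hasDerivAt_logLift h0, ae_hasDerivAt_prim (p := p)] with y h1 h2 hy
    have hne : prim p y ≠ 0 := h0 y (by rwa [uIcc_of_le zero_le_one] at hy)
    refine ((h1 hy).fun_neg.cexp.fun_smul (h2 hy)).congr_deriv ?_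
    simp only [smul_eq_mul]
    field_simp
    ring)
  have e0 := hC 0 left_mem_uIcc
  have e1 := hC x (by rwa [uIcc_of_le zero_le_one])
  simp only [logLift_zero, prim_zero, neg_zero, Complex.exp_zero, smul_eq_mul, mul_one] at e0 e1
  rw [← e0, Complex.exp_neg, inv_mul_eq_one₀ (Complex.exp_ne_zero _)] at e1
  exact e1

theorem integral_norm_le_norm (g : Lp ℂ 2 μI) : ∫ x, ‖g x‖ ∂μI ≤ ‖g‖ := by
  rw [integral_norm_eq_lintegral_enorm (Lp.aestronglyMeasurable g), Lp.norm_def,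
    ← eLpNorm_one_eq_lintegral_enorm]
  exact ENNReal.toReal_mono (Lp.eLpNorm_ne_top g)
    (eLpNorm_le_eLpNorm_of_exponent_le one_le_two (Lp.aestronglyMeasurable g))

/-- The embedding of `H¹` into continuous functions, with constant `1`: both primitives start at
`1`, and `L¹ ≤ L²` on a probability space. -/
theorem norm_prim_sub_le {x : ℝ} (hx : x ∈ Icc (0 : ℝ) 1) :
    ‖prim p x - prim q x‖ ≤ dist p q := by
  have hi : ∀ r : L2Pair ℂ, IntervalIntegrable r.2 volume 0 x := fun r ↦
    (intervalIntegrable_coe_Lp r.2).mono_set (uIcc_subset_unit hx)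
  have h1 : prim p x - prim q x = ∫ t in (0 : ℝ)..x, (p.2 t - q.2 t) := by
    rw [intervalIntegral.integral_sub (hi p) (hi q), prim, prim]; ring
  have hint : Integrable (fun t ↦ p.2 t - q.2 t) μI :=
    (integrable_coe_Lp p.2).sub (integrable_coe_Lp q.2)
  calc ‖prim p x - prim q x‖ ≤ ∫ t in (0 : ℝ)..x, ‖p.2 t - q.2 t‖ := by
        rw [h1]; exact intervalIntegral.norm_integral_le_integral_norm hx.1
    _ ≤ ∫ t in (0 : ℝ)..1, ‖p.2 t - q.2 t‖ :=
        intervalIntegral.integral_mono_interval le_rfl hx.1 hx.2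
          (.of_forall fun _ ↦ norm_nonneg _) (intervalIntegrable_iff_μI.mpr hint.norm)
    _ = ∫ t, ‖(p.2 - q.2 : Lp ℂ 2 μI) t‖ ∂μI := by
        rw [← integral_μI]
        refine integral_congr_ae ?_
        filter_upwards [Lp.coeFn_sub p.2 q.2] with t ht
        rw [ht, Pi.sub_apply]
    _ ≤ ‖p.2 - q.2‖ := integral_norm_le_norm _
    _ ≤ dist p q := by rw [← dist_eq_norm, Prod.dist_eq]; exact le_max_right _ _

/-- The total phase is locally constant on the admissible functions without zeros. -/
theorem logLift_one_eq {η : ℝ} (hp : p ∈ Admissible α) (hq : q ∈ Admissible α)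
    (hη : ∀ x ∈ Icc (0 : ℝ) 1, η ≤ ‖prim p x‖) (hpq : dist p q < η) :
    (∀ x ∈ Icc (0 : ℝ) 1, prim q x ≠ 0) ∧ logLift q 1 = logLift p 1 := by
  have hη0 : 0 < η := dist_nonneg.trans_lt hpq
  have hp0 : ∀ x ∈ Icc (0 : ℝ) 1, prim p x ≠ 0 := fun x hx ↦
    norm_pos_iff.mp (hη0.trans_le (hη x hx))
  have hd : ∀ x ∈ Icc (0 : ℝ) 1, ‖prim q x - prim p x‖ < ‖prim p x‖ := fun x hx ↦ by
    rw [norm_sub_rev]; exact (norm_prim_sub_le hx).trans_lt (hpq.trans_le (hη x hx))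
  have hq0 : ∀ x ∈ Icc (0 : ℝ) 1, prim q x ≠ 0 := fun x hx h ↦ by
    have := hd x hx
    simp [h] at this
  refine ⟨hq0, ?_⟩
  have hslit : ∀ x ∈ Icc (0 : ℝ) 1, prim q x / prim p x ∈ Complex.slitPlane := fun x hx ↦ by
    have h1 : prim q x / prim p x = 1 + (prim q x - prim p x) / prim p x := by
      field_simp [hp0 x hx]; ring
    rw [h1]
    refine Complex.mem_slitPlane_of_norm_lt_one ?_
    rw [norm_div, div_lt_one (norm_pos_iff.mpr (hp0 x hx))]
    exact hd x hx
  have h01 : (0 : ℝ) ∈ Icc (0 : ℝ) 1 := left_mem_Icc.mpr zero_le_one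
  have h11 : (1 : ℝ) ∈ Icc (0 : ℝ) 1 := right_mem_Icc.mpr zero_le_one
  -- The ratio stays in the unit disc around `1`, so its principal logarithm is continuous. It
  -- vanishes at both ends, where `prim p` and `prim q` coincide.
  have key := Complex.eq_of_exp_eq_one (s := Icc (0 : ℝ) 1)
    (f := fun x ↦ logLift q x - logLift p x - Complex.log (prim q x / prim p x))
    isPreconnected_Icc
    (((continuousOn_logLift hq0).sub (continuousOn_logLift hp0)).sub
      ((continuousOn_prim.div continuousOn_prim hp0).clog hslit))
    (fun x hx ↦ by
      rw [Complex.exp_sub, Complex.exp_sub, exp_logLift hq0 hx, exp_logLift hp0 hx,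
        Complex.exp_log (div_ne_zero (hq0 x hx) (hp0 x hx)),
        div_self (div_ne_zero (hq0 x hx) (hp0 x hx))]) h01 h11
  simp only [logLift_zero, prim_zero, Admissible.prim_one hp, Admissible.prim_one hq,
    div_self (Complex.exp_ne_zero _), Complex.log_one, sub_zero, div_one] at key
  exact sub_eq_zero.mp key.symm

/-- With continuous representatives `r`, `ϑ` of the polar form, `log r + iϑ` is another continuous
logarithm vanishing at `0`, so it equals `logLift p`. -/
theorem IsTwistLocalMin.logLift_one {L : ℝ} {N : ℕ} {ρ₀ ε : ℝ} {M : ℕ}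
    (h : IsTwistLocalMin L N α ρ₀ ε M p) (hρ₀ : 0 < ρ₀) :
    (∀ x ∈ Icc (0 : ℝ) 1, ρ₀ ≤ ‖prim p x‖) ∧
      logLift p 1 = (2 * Real.pi * M + α : ℝ) * Complex.I := by
  obtain ⟨ρ, ⟨-, ⟨r, hr, hρr, hr0, hr1⟩, hρ⟩, θ, ⟨-, ⟨ϑ, hϑ, hθϑ, hϑ0, hϑ1⟩⟩, hpol⟩ := h.polar
  have hrge : ∀ x ∈ Icc (0 : ℝ) 1, ρ₀ ≤ r x := by
    -- Written as the equation `max ρ₀ r = r`, the a.e. lower bound extends to every point by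
    -- continuity.
    have := eqOn_of_ae_eq_μI (f := fun x ↦ max ρ₀ (r x)) (g := r) (by
      filter_upwards [hρ, hρr] with x h1 h2
      rw [← h2, max_eq_right h1]) (continuousOn_const.sup hr) hr
    exact fun x hx ↦ max_eq_right_iff.mp (this hx)
  have hrpos : ∀ x ∈ Icc (0 : ℝ) 1, 0 < r x := fun x hx ↦ hρ₀.trans_le (hrge x hx)
  have heq : EqOn (prim p) (fun x ↦ (r x : ℂ) * Complex.exp ((ϑ x : ℂ) * Complex.I))
      (Icc 0 1) := by
    refine eqOn_of_ae_eq_μI ?_ continuousOn_prim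
      ((Complex.continuous_ofReal.comp_continuousOn hr).mul
        ((Complex.continuous_ofReal.comp_continuousOn hϑ).mul continuousOn_const).cexp)
    filter_upwards [Admissible.ae_eq_prim h.mem, hpol, hρr, hθϑ] with x h1 h2 h3 h4
    rw [← h1, h2, h3, h4]
  have hnorm : ∀ x ∈ Icc (0 : ℝ) 1, ‖prim p x‖ = r x := fun x hx ↦ by
    rw [heq hx, norm_mul, Complex.norm_exp_ofReal_mul_I, mul_one, Complex.norm_real,
      Real.norm_of_nonneg (hrpos x hx).le]
  have h0 : ∀ x ∈ Icc (0 : ℝ) 1, prim p x ≠ 0 := fun x hx ↦ by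
    rw [← norm_pos_iff, hnorm x hx]; exact hrpos x hx
  refine ⟨fun x hx ↦ (hnorm x hx).symm ▸ hrge x hx, ?_⟩
  have h01 : (0 : ℝ) ∈ Icc (0 : ℝ) 1 := left_mem_Icc.mpr zero_le_one
  have h11 : (1 : ℝ) ∈ Icc (0 : ℝ) 1 := right_mem_Icc.mpr zero_le_one
  have key := Complex.eq_of_exp_eq_one (s := Icc (0 : ℝ) 1)
    (f := fun x ↦ logLift p x - (Real.log (r x) : ℂ) - (ϑ x : ℂ) * Complex.I)
    isPreconnected_Icc
    (((continuousOn_logLift h0).sub (Complex.continuous_ofReal.comp_continuousOn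
        (hr.log fun x hx ↦ (hrpos x hx).ne'))).sub
      ((Complex.continuous_ofReal.comp_continuousOn hϑ).mul continuousOn_const))
    (fun x hx ↦ by
      have hr0 : (r x : ℂ) ≠ 0 := Complex.ofReal_ne_zero.mpr (hrpos x hx).ne'
      rw [Complex.exp_sub, Complex.exp_sub, exp_logLift h0 hx, heq hx, ← Complex.ofReal_exp,
        Real.exp_log (hrpos x hx), mul_div_cancel_left₀ _ hr0, div_self (Complex.exp_ne_zero _)])
    h01 h11
  simp only [logLift_zero, hr0, hr1, hϑ0, hϑ1, Real.log_one, Complex.ofReal_zero, sub_zero,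
    zero_mul] at key
  exact sub_eq_zero.mp key.symm

end Cholesteric

/-! ### Lower bounds for the energy. -/

noncomputable section

namespace Cholesteric

variable {p q : L2Pair ℂ} {α : ℝ}

/-- The Modica–Mortola energy density. -/
def wellDensity (ε : ℝ) (p : L2Pair ℂ) (x : ℝ) : ℝ :=
  ε / 2 * ‖p.2 x‖ ^ 2 + 1 / (4 * ε) * (‖prim p x‖ ^ 2 - 1) ^ 2

/-- The current `u₁ u₂' - u₂ u₁'`. -/
def current (p : L2Pair ℂ) (x : ℝ) : ℝ :=
  (prim p x).re * (p.2 x).im - (prim p x).im * (p.2 x).re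

theorem wellDensity_nonneg {ε : ℝ} (hε : 0 < ε) (x : ℝ) : 0 ≤ wellDensity ε p x := by
  unfold wellDensity; positivity

theorem abs_current_le (x : ℝ) : |current p x| ≤ ‖prim p x‖ * ‖p.2 x‖ := by
  have : current p x = (starRingEnd ℂ (prim p x) * p.2 x).im := by
    simp [current]; ring
  rw [this]
  refine (Complex.abs_im_le_norm _).trans ?_
  rw [norm_mul, Complex.norm_conj]

theorem continuousOn_wellPotential :
    ContinuousOn (fun x ↦ (‖prim p x‖ ^ 2 - 1) ^ 2) (uIcc (0 : ℝ) 1) := by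
  rw [uIcc_of_le zero_le_one]
  exact ((continuousOn_prim.norm.pow 2).sub continuousOn_const).pow 2

theorem integrable_wellPotential : Integrable (fun x ↦ (‖prim p x‖ ^ 2 - 1) ^ 2) μI :=
  intervalIntegrable_iff_μI.mp continuousOn_wellPotential.intervalIntegrable

theorem integrable_wellDensity (ε : ℝ) : Integrable (wellDensity ε p) μI :=
  (((Lp.memLp p.2).norm.integrable_sq).const_mul _).add (integrable_wellPotential.const_mul _)

theorem memLp_current : MemLp (current p) 2 μI := by
  obtain ⟨C, hC⟩ := (absolutelyContinuous_prim (p := p)).exists_bound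
  have hV : AEStronglyMeasurable (prim p) μI :=
    (intervalIntegrable_iff_μI.mp
      absolutelyContinuous_prim.continuousOn.intervalIntegrable).aestronglyMeasurable
  have hg := Lp.aestronglyMeasurable p.2
  refine MemLp.of_le_mul (c := C) (Lp.memLp p.2) ?_ ?_
  · exact (hV.re.mul hg.im).sub (hV.im.mul hg.re)
  · rw [ae_restrict_iff' measurableSet_Ioo]
    refine .of_forall fun x hx ↦ (abs_current_le x).trans ?_
    gcongr
    exact hC x (by rw [uIcc_of_le zero_le_one]; exact Ioo_subset_Icc_self hx)

theorem integrable_current : Integrable (current p) μI := memLp_current.integrable one_le_two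

theorem integrable_current_sub_sq (K : ℝ) : Integrable (fun x ↦ (current p x - K) ^ 2) μI :=
  (memLp_current.sub (memLp_const K)).integrable_sq

theorem energy_eq {L : ℝ} {N : ℕ} {ε : ℝ} (hp : p ∈ Admissible α) :
    energy L N ε p = (∫ x, wellDensity ε p x ∂μI) +
      L / 2 * ∫ x, (current p x - 2 * Real.pi * N) ^ 2 ∂μI := by
  rw [← integral_const_mul, ← integral_add (integrable_wellDensity ε)
    ((integrable_current_sub_sq _).const_mul _), energy]
  refine integral_congr_ae ?_
  filter_upwards [Admissible.ae_eq_prim hp] with x hx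
  rw [hx]; rfl

/-- With `r = ‖prim p‖`, one has `r' = r Re(u'/u)`, so the left side is `|(r - r³/3)'|`. Since `|r'|
≤ |u'|`, the bound is Young's inequality between the two terms of the density. -/
theorem abs_profile_deriv_le {ε : ℝ} (hε : 0 < ε) {x : ℝ} (h0 : prim p x ≠ 0) :
    |(1 - ‖prim p x‖ ^ 2) * (‖prim p x‖ * (p.2 x * (prim p x)⁻¹).re)| ≤
      √2 * wellDensity ε p x := by
  have hn : 0 < ‖prim p x‖ := norm_pos_iff.mpr h0
  have h1 : |‖prim p x‖ * (p.2 x * (prim p x)⁻¹).re| ≤ ‖p.2 x‖ := by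
    rw [abs_mul, abs_norm]
    calc _ ≤ ‖prim p x‖ * ‖p.2 x * (prim p x)⁻¹‖ := by
          gcongr; exact Complex.abs_re_le_norm _
      _ = ‖p.2 x‖ := by rw [norm_mul, norm_inv]; field_simp
  rw [abs_mul]
  refine (mul_le_mul_of_nonneg_left h1 (abs_nonneg _)).trans ?_
  set a := ‖p.2 x‖ with ha
  set b := |1 - ‖prim p x‖ ^ 2| with hb
  have hb2 : (‖prim p x‖ ^ 2 - 1) ^ 2 = b ^ 2 := by rw [hb, sq_abs]; ring
  rw [wellDensity, hb2, ← ha]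
  have h2 : (√2) ^ 2 = 2 := Real.sq_sqrt (by norm_num)
  have key : √2 * (ε / 2 * a ^ 2 + 1 / (4 * ε) * b ^ 2) - b * a
      = √2 / (4 * ε) * (√2 * ε * a - b) ^ 2 := by
    field_simp
    linear_combination (-2 * ε ^ 2 * a ^ 2 * √2 + 4 * ε * a * b) * h2
  have : 0 ≤ √2 / (4 * ε) * (√2 * ε * a - b) ^ 2 := by positivity
  linarith

theorem abs_profile_sub_le {ε : ℝ} (hε : 0 < ε) (h0 : ∀ x ∈ Icc (0 : ℝ) 1, prim p x ≠ 0)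
    {a b : ℝ} (ha : a ∈ Icc (0 : ℝ) 1) (hb : b ∈ Icc (0 : ℝ) 1) (hab : a ≤ b) :
    |(‖prim p b‖ - ‖prim p b‖ ^ 3 / 3) - (‖prim p a‖ - ‖prim p a‖ ^ 3 / 3)| ≤
      √2 * ∫ x in a..b, wellDensity ε p x := by
  have hsub : uIcc a b ⊆ uIcc (0 : ℝ) 1 := by
    rw [uIcc_of_le hab, uIcc_of_le zero_le_one]; exact Icc_subset_Icc ha.1 hb.2
  have hexp : ∀ x ∈ Icc (0 : ℝ) 1, Real.exp (logLift p x).re = ‖prim p x‖ := fun x hx ↦ by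
    rw [← exp_logLift h0 hx, Complex.norm_exp]
  -- Writing the modulus as `exp (Re logLift)` makes the profile `r - r³/3` a smooth function of an
  -- absolutely continuous one.
  have hre : ContDiff ℝ 1 fun z : ℂ ↦ Real.exp z.re := Real.contDiff_exp.comp Complex.reCLM.contDiff
  have hac := ((absolutelyContinuous_logLift h0).comp_contDiff
    (hre.sub ((hre.pow 3).div_const 3))).mono hsub
  have hi : IntervalIntegrable (fun x ↦ (1 - Real.exp (logLift p x).re ^ 2) *
      (Real.exp (logLift p x).re * (p.2 x * (prim p x)⁻¹).re)) volume 0 1 := by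
    have hr := (absolutelyContinuous_logLift h0).comp_contDiff hre
    have h1 : IntervalIntegrable (fun x ↦ (p.2 x * (prim p x)⁻¹).re) volume 0 1 :=
      intervalIntegrable_iff_μI.mpr
        (intervalIntegrable_iff_μI.mp (intervalIntegrable_logDeriv h0)).re
    exact (h1.continuousOn_mul hr.continuousOn).continuousOn_mul
      (continuousOn_const.sub (hr.continuousOn.pow 2))
  have hftc := hac.integral_eq_sub (f' := fun x ↦ (1 - Real.exp (logLift p x).re ^ 2) *
      (Real.exp (logLift p x).re * (p.2 x * (prim p x)⁻¹).re)) (by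
    filter_upwards [ae_hasDerivAt_logLift h0] with x hx hxab
    have h1 : HasDerivAt (fun y ↦ (logLift p y).re) (p.2 x * (prim p x)⁻¹).re x :=
      (Complex.reCLM.hasFDerivAt.comp_hasDerivAt x (hx (hsub hxab)))
    refine (h1.exp.fun_sub ((h1.exp.fun_pow 3).div_const 3)).congr_deriv ?_
    push_cast
    ring) (hi.mono_set hsub)
  simp only [hexp a ha, hexp b hb] at hftc
  rw [← hftc, ← intervalIntegral.integral_const_mul, ← Real.norm_eq_abs]
  refine intervalIntegral.norm_integral_le_of_norm_le hab (.of_forall fun x hx ↦ ?_)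
    (((intervalIntegrable_iff_μI.mpr (integrable_wellDensity ε)).mono_set hsub).const_mul _)
  have hx01 : x ∈ Icc (0 : ℝ) 1 := ⟨ha.1.trans hx.1.le, hx.2.trans hb.2⟩
  rw [hexp x hx01, Real.norm_eq_abs]
  exact abs_profile_deriv_le hε (h0 x hx01)

/-- Leaving the well `|u| = 1` down to modulus `η` and coming back costs about `2√2/3`. -/
theorem le_integral_wellDensity {ε η : ℝ} (hε : 0 < ε) (hp : p ∈ Admissible α)
    (h0 : ∀ x ∈ Icc (0 : ℝ) 1, prim p x ≠ 0) {x₀ : ℝ} (hx₀ : x₀ ∈ Icc (0 : ℝ) 1)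
    (hη : ‖prim p x₀‖ ≤ η) : 2 * √2 / 3 - √2 * η ≤ ∫ x, wellDensity ε p x ∂μI := by
  have hi := intervalIntegrable_iff_μI.mpr (integrable_wellDensity (p := p) ε)
  have hx₀' : x₀ ∈ uIcc (0 : ℝ) 1 := by rwa [uIcc_of_le zero_le_one]
  have e1 := (abs_le.mp (abs_profile_sub_le hε h0 (left_mem_Icc.mpr zero_le_one) hx₀ hx₀.1)).1
  have e2 := (le_abs_self _).trans
    (abs_profile_sub_le hε h0 hx₀ (right_mem_Icc.mpr zero_le_one) hx₀.2)
  rw [Admissible.prim_one hp, Complex.norm_exp_ofReal_mul_I] at e2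
  rw [prim_zero, norm_one] at e1
  rw [integral_μI, ← intervalIntegral.integral_add_adjacent_intervals
    (hi.mono_set (uIcc_subset_uIcc left_mem_uIcc hx₀'))
    (hi.mono_set (uIcc_subset_uIcc hx₀' right_mem_uIcc))]
  set I := ∫ x in (0 : ℝ)..x₀, wellDensity ε p x
  set J := ∫ x in x₀..(1 : ℝ), wellDensity ε p x
  have hn : 0 ≤ ‖prim p x₀‖ ^ 3 := by positivity
  have h2 : √2 * √2 = 2 := Real.mul_self_sqrt (by norm_num)
  -- The profile is `2/3` at modulus `1` and at most `η` at `x₀`, so each of the two legs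
  -- contributes at least `2/3 - η`.
  have h3 : 4 / 3 - 2 * η ≤ √2 * (I + J) := by linarith
  have h4 : √2 * (4 / 3 - 2 * η) ≤ √2 * (√2 * (I + J)) :=
    mul_le_mul_of_nonneg_left h3 (Real.sqrt_nonneg 2)
  rw [← mul_assoc, h2] at h4
  linarith

theorem im_logLift_one (h0 : ∀ x ∈ Icc (0 : ℝ) 1, prim p x ≠ 0) :
    (logLift p 1).im = ∫ x, current p x / ‖prim p x‖ ^ 2 ∂μI := by
  have hi := intervalIntegrable_iff_μI.mp (intervalIntegrable_logDeriv h0)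
  rw [logLift, ← integral_μI]
  refine (Complex.imCLM.integral_comp_comm hi).symm.trans
    (integral_congr_ae (.of_forall fun x ↦ ?_))
  simp only [Complex.imCLM_apply, Complex.mul_im, Complex.inv_re, Complex.inv_im, current,
    Complex.sq_norm]
  ring

/-- The difference is `∫ c (1 - r²)/r²` with `c` the current and `r` the modulus; Young's inequality
with weight `s` splits it. The choice `s = √ε` below balances the terms, since the potential
integral is `O(ε)`. -/
theorem abs_im_logLift_one_sub_le {η s : ℝ} (hη : 0 < η) (hs : 0 < s)
    (hge : ∀ x ∈ Icc (0 : ℝ) 1, η ≤ ‖prim p x‖) (K : ℝ) :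
    |(logLift p 1).im - ∫ x, current p x ∂μI| ≤
      (s * (2 * (∫ x, (current p x - K) ^ 2 ∂μI) + 2 * K ^ 2) +
        (∫ x, (‖prim p x‖ ^ 2 - 1) ^ 2 ∂μI) / s) / (2 * η ^ 2) := by
  have h0 : ∀ x ∈ Icc (0 : ℝ) 1, prim p x ≠ 0 := fun x hx ↦
    norm_pos_iff.mp (hη.trans_le (hge x hx))
  have hi : Integrable (fun x ↦ current p x / ‖prim p x‖ ^ 2) μI := by
    refine intervalIntegrable_iff_μI.mp ?_
    refine (intervalIntegrable_iff_μI.mpr integrable_current).mul_continuousOn ?_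
    rw [uIcc_of_le zero_le_one]
    exact (continuousOn_prim.norm.pow 2).inv₀ fun x hx ↦
      pow_ne_zero 2 (norm_ne_zero_iff.mpr (h0 x hx))
  rw [im_logLift_one h0, ← integral_sub hi integrable_current]
  have hA := integrable_current_sub_sq (p := p) K
  have hB := integrable_wellPotential (p := p)
  have hG : Integrable (fun x ↦ (s * (2 * (current p x - K) ^ 2 + 2 * K ^ 2) +
      (‖prim p x‖ ^ 2 - 1) ^ 2 / s) / (2 * η ^ 2)) μI :=
    ((((hA.const_mul 2).add (integrable_const _)).const_mul s).add (hB.div_const s)).div_const _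
  have hGe : ∫ x, (s * (2 * (current p x - K) ^ 2 + 2 * K ^ 2) +
      (‖prim p x‖ ^ 2 - 1) ^ 2 / s) / (2 * η ^ 2) ∂μI =
      (s * (2 * (∫ x, (current p x - K) ^ 2 ∂μI) + 2 * K ^ 2) +
        (∫ x, (‖prim p x‖ ^ 2 - 1) ^ 2 ∂μI) / s) / (2 * η ^ 2) := by
    rw [integral_div, integral_add (((hA.const_mul 2).fun_add (integrable_const _)).const_mul s)
      (hB.div_const s), integral_const_mul, integral_add (hA.const_mul 2) (integrable_const _),
      integral_const_mul, integral_div]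
    simp
  rw [← hGe, ← Real.norm_eq_abs]
  refine norm_integral_le_of_norm_le hG ?_
  rw [ae_restrict_iff' measurableSet_Ioo]
  refine .of_forall fun x hx ↦ ?_
  have hx' := hge x (Ioo_subset_Icc_self hx)
  have hn : 0 < ‖prim p x‖ := hη.trans_le hx'
  set c := current p x
  set r := ‖prim p x‖
  have e1 : c / r ^ 2 - c = c * (1 - r ^ 2) / r ^ 2 := by field_simp
  rw [e1, Real.norm_eq_abs, abs_div, abs_of_pos (pow_pos hn 2), abs_mul]
  have e2 : |c| * |1 - r ^ 2| ≤ (s * c ^ 2 + (r ^ 2 - 1) ^ 2 / s) / 2 := by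
    have hsq : (s * |c| - |1 - r ^ 2|) ^ 2 / s = s * c ^ 2 + (r ^ 2 - 1) ^ 2 / s
        - 2 * (|c| * |1 - r ^ 2|) := by
      have h3 : |c| ^ 2 = c ^ 2 := sq_abs c
      have h4 : |1 - r ^ 2| ^ 2 = (r ^ 2 - 1) ^ 2 := by rw [sq_abs]; ring
      rw [← h3, ← h4]; field_simp; ring
    have : 0 ≤ (s * |c| - |1 - r ^ 2|) ^ 2 / s := by positivity
    linarith
  have e3 : c ^ 2 ≤ 2 * (c - K) ^ 2 + 2 * K ^ 2 := by nlinarith [sq_nonneg (c - 2 * K)]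
  calc |c| * |1 - r ^ 2| / r ^ 2 ≤ |c| * |1 - r ^ 2| / η ^ 2 := by gcongr
    _ ≤ ((s * c ^ 2 + (r ^ 2 - 1) ^ 2 / s) / 2) / η ^ 2 := by gcongr
    _ ≤ ((s * (2 * (c - K) ^ 2 + 2 * K ^ 2) + (r ^ 2 - 1) ^ 2 / s) / 2) / η ^ 2 := by gcongr
    _ = _ := by rw [div_div]

/-- Jensen's inequality with an error: integrate the tangent-line bound `y² ≥ 2Dy - D²` at `y =
current - K`. -/
theorem le_integral_current_sub_sq {K D δ : ℝ}
    (h : |D - ((∫ x, current p x ∂μI) - K)| ≤ δ) :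
    D ^ 2 - 2 * |D| * δ ≤ ∫ x, (current p x - K) ^ 2 ∂μI := by
  have hi : Integrable (fun x ↦ 2 * D * (current p x - K)) μI :=
    (integrable_current.sub (integrable_const K)).const_mul _
  have h1 : ∫ x, (2 * D * (current p x - K) - D ^ 2) ∂μI ≤
      ∫ x, (current p x - K) ^ 2 ∂μI := by
    refine integral_mono (hi.sub (integrable_const _)) (integrable_current_sub_sq K) fun x ↦ ?_
    nlinarith [sq_nonneg (current p x - K - D)]
  rw [integral_sub hi (integrable_const _), integral_const_mul,
    integral_sub integrable_current (integrable_const K)] at h1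
  simp only [integral_const, probReal_univ, one_smul] at h1
  set m := ∫ x, current p x ∂μI
  have h2 : |D * (D - (m - K))| ≤ |D| * δ := by
    rw [abs_mul]; exact mul_le_mul_of_nonneg_left h (abs_nonneg _)
  nlinarith [le_abs_self (D * (D - (m - K)))]

/-- The lower bound for the energy of a function with total phase `Φ` whose modulus is at least `η`,
with equality somewhere. -/
theorem exists_lt_energy {L : ℝ} (hL : 0 < L) (N : ℕ) (α Φ : ℝ) {η h : ℝ} (hη : 0 < η)
    (hηh : √2 * η ≤ h / 2) :
    ∃ εh : ℝ, 0 < εh ∧ ∀ ε : ℝ, 0 < ε → ε < εh → ∀ p ∈ Admissible α,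
      (∀ x ∈ Icc (0 : ℝ) 1, η ≤ ‖prim p x‖) → (∃ x ∈ Icc (0 : ℝ) 1, ‖prim p x‖ ≤ η) →
      (logLift p 1).im = Φ →
      L / 2 * (Φ - 2 * Real.pi * N) ^ 2 + 2 * √2 / 3 - h ≤ energy L N ε p := by
  set K := 2 * Real.pi * N with hK
  set D := Φ - K with hD
  -- `Λ` is the a priori ceiling: arguing by contradiction, the energy is below `Λ - h`, which
  -- bounds both the twist integral and the potential.
  set Λ := L / 2 * D ^ 2 + 2 * √2 / 3 with hΛ
  have hΛ0 : 0 ≤ Λ := by positivity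
  have hh : 0 < h := by
    have : 0 < √2 * η := by positivity
    linarith
  -- `C` is chosen so that the phase error costs `√ε C` in energy; the threshold for `ε` makes this
  -- less than `h/2`. The other half of `h` absorbs `√2 η`.
  set C := L * |D| * ((2 * (2 * Λ / L) + 2 * K ^ 2 + 4 * Λ) / (2 * η ^ 2)) with hC
  have hC0 : 0 ≤ C := by positivity
  refine ⟨(h / (2 * (C + 1))) ^ 2, by positivity, fun ε hε hεh p hp hge ⟨x₀, hx₀, hle⟩ hΦ ↦ ?_⟩
  by_contra hlt
  rw [not_le] at hlt
  have h0 : ∀ x ∈ Icc (0 : ℝ) 1, prim p x ≠ 0 := fun x hx ↦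
    norm_pos_iff.mp (hη.trans_le (hge x hx))
  have hE := energy_eq (L := L) (N := N) (ε := ε) hp
  rw [← hK] at hE
  set W := ∫ x, wellDensity ε p x ∂μI with hW
  set A := ∫ x, (current p x - K) ^ 2 ∂μI with hA
  set B := ∫ x, (‖prim p x‖ ^ 2 - 1) ^ 2 ∂μI with hB
  have hA0 : 0 ≤ A := integral_nonneg fun x ↦ sq_nonneg _
  have hW0 : 0 ≤ W := integral_nonneg fun x ↦ wellDensity_nonneg hε x
  have hLA : 0 ≤ L / 2 * A := by positivity
  have hAΛ : A ≤ 2 * Λ / L := by rw [le_div_iff₀ hL]; linarith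
  have hBW : 1 / (4 * ε) * B ≤ W := by
    rw [hB, ← integral_const_mul]
    refine integral_mono (integrable_wellPotential.const_mul _) (integrable_wellDensity ε)
      fun x ↦ ?_
    have : 0 ≤ ε / 2 * ‖p.2 x‖ ^ 2 := by positivity
    simp only [wellDensity]
    linarith
  have hBΛ : B ≤ 4 * ε * Λ := by
    have h1 : 1 / (4 * ε) * B ≤ Λ := by linarith
    rw [one_div, inv_mul_le_iff₀ (by positivity)] at h1
    exact h1
  set s := √ε with hs
  have hs0 : 0 < s := Real.sqrt_pos.mpr hε
  have hss : s * s = ε := Real.mul_self_sqrt hε.le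
  have hδ := abs_im_logLift_one_sub_le hη hs0 hge K
  rw [hΦ, ← hA, ← hB] at hδ
  have hBs : B / s ≤ s * (4 * Λ) := by
    rw [div_le_iff₀ hs0]
    calc B ≤ 4 * ε * Λ := hBΛ
      _ = s * (4 * Λ) * s := by rw [← hss]; ring
  have hδ' : |D - ((∫ x, current p x ∂μI) - K)| ≤
      s * ((2 * (2 * Λ / L) + 2 * K ^ 2 + 4 * Λ) / (2 * η ^ 2)) := by
    have e : D - ((∫ x, current p x ∂μI) - K) = Φ - ∫ x, current p x ∂μI := by rw [hD]; ring
    rw [e]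
    refine hδ.trans ?_
    rw [← mul_div_assoc]
    gcongr
    calc s * (2 * A + 2 * K ^ 2) + B / s
        ≤ s * (2 * (2 * Λ / L) + 2 * K ^ 2) + s * (4 * Λ) := by gcongr
      _ = _ := by ring
  have hcur := le_integral_current_sub_sq hδ'
  rw [← hA] at hcur
  have hwell := le_integral_wellDensity hε hp h0 hx₀ hle
  rw [← hW] at hwell
  have hsC : s * C < h / 2 := by
    have h1 : s < h / (2 * (C + 1)) := by
      rw [hs]; exact (Real.sqrt_lt' (by positivity)).mpr hεh
    rw [lt_div_iff₀ (by positivity)] at h1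
    nlinarith
  have hLcur := mul_le_mul_of_nonneg_left hcur (by positivity : 0 ≤ L / 2)
  have : L / 2 * (D ^ 2 - 2 * |D| * (s * ((2 * (2 * Λ / L) + 2 * K ^ 2 + 4 * Λ) / (2 * η ^ 2))))
      = L / 2 * D ^ 2 - s * C := by rw [hC]; ring
  linarith

/-! ### The connectedness argument along a path. -/

/-- Along a continuous path that changes the total phase, the minimal modulus takes every value `η`
below its initial value before the total phase changes. -/
theorem exists_norm_prim_eq {γ : unitInterval → L2Pair ℂ} (hγ : Continuous γ)
    (hadm : ∀ t, γ t ∈ Admissible α) {η : ℝ} (hη : 0 < η)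
    (h0 : ∀ x ∈ Icc (0 : ℝ) 1, η < ‖prim (γ 0) x‖) (h01 : logLift (γ 1) 1 ≠ logLift (γ 0) 1) :
    ∃ t, (∀ x ∈ Icc (0 : ℝ) 1, η ≤ ‖prim (γ t) x‖) ∧ (∃ x ∈ Icc (0 : ℝ) 1, ‖prim (γ t) x‖ ≤ η) ∧
      logLift (γ t) 1 = logLift (γ 0) 1 := by
  by_contra! hcon
  -- If no such time exists, this set is clopen and contains `0`, hence also `1`, where the phase
  -- differs.
  let A : Set unitInterval :=
    {t | (∀ x ∈ Icc (0 : ℝ) 1, η < ‖prim (γ t) x‖) ∧ logLift (γ t) 1 = logLift (γ 0) 1}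
  have hnear : ∀ t, ∀ r > 0, ∀ᶠ s in nhds t, dist (γ t) (γ s) < r := fun t r hr ↦ by
    have := hγ.continuousAt.eventually (Metric.ball_mem_nhds (γ t) hr)
    filter_upwards [this] with s hs
    rw [dist_comm]; exact hs
  have hopen : IsOpen A := by
    rw [isOpen_iff_mem_nhds]
    rintro t ⟨ht1, ht2⟩
    obtain ⟨x, hx, hmin⟩ := isCompact_Icc.exists_isMinOn (nonempty_Icc.mpr zero_le_one)
      (continuousOn_prim (p := γ t)).norm
    have hgap : 0 < ‖prim (γ t) x‖ - η := sub_pos.mpr (ht1 x hx)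
    filter_upwards [hnear t η hη, hnear t _ hgap] with s h1 h2
    refine ⟨fun y hy ↦ ?_, ((logLift_one_eq (hadm t) (hadm s)
      (fun y hy ↦ (ht1 y hy).le) h1).2).trans ht2⟩
    have h3 := norm_prim_sub_le (p := γ t) (q := γ s) hy
    have h4 := norm_sub_norm_le (prim (γ t) y) (prim (γ s) y)
    have h5 : ‖prim (γ t) x‖ ≤ ‖prim (γ t) y‖ := hmin hy
    linarith
  have hclosed : IsClosed A := by
    rw [← closure_subset_iff_isClosed]
    intro t ht
    have hge : ∀ x ∈ Icc (0 : ℝ) 1, η ≤ ‖prim (γ t) x‖ := by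
      intro x hx
      refine le_of_forall_pos_lt_add fun r hr ↦ ?_
      obtain ⟨s, hs, hsA⟩ := mem_closure_iff_nhds.mp ht _ (hnear t r hr)
      have h3 := norm_prim_sub_le (p := γ t) (q := γ s) hx
      have h4 := norm_sub_norm_le (prim (γ s) x) (prim (γ t) x)
      rw [norm_sub_rev] at h4
      have h5 := hsA.1 x hx
      have h6 : dist (γ t) (γ s) < r := hs
      linarith
    obtain ⟨s, hs, hsA⟩ := mem_closure_iff_nhds.mp ht _ (hnear t η hη)
    have hlift : logLift (γ t) 1 = logLift (γ 0) 1 :=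
      ((logLift_one_eq (hadm t) (hadm s) hge hs).2).symm.trans hsA.2
    refine ⟨fun x hx ↦ ?_, hlift⟩
    by_contra hle
    -- A limit of times in `A` only keeps `η ≤ ‖prim‖`; equality at a point is exactly the excluded
    -- configuration.
    exact hcon t hge ⟨x, hx, not_lt.mp hle⟩ hlift
  have huniv : A = univ := IsClopen.eq_univ ⟨hclosed, hopen⟩ ⟨0, h0, rfl⟩
  exact h01 (huniv ▸ mem_univ (1 : unitInterval) : (1 : unitInterval) ∈ A).2

end Cholesteric

end

/-! ### The energy barrier. -/

theorem theorem4p1 (L : ℝ) (hL : 0 < L) (N : ℕ) (hN : 0 < N)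
    (α : ℝ) (hα : α ∈ Set.Ico 0 (2 * Real.pi)) (M₁ M₂ : ℕ) (hM : M₁ ≠ M₂)
    (ρ₀ : ℝ) (hρ₀ : ρ₀ ∈ Set.Ioo (0 : ℝ) 1) (h : ℝ) (hh : 0 < h) :
    ∃ εh : ℝ, 0 < εh ∧ ∀ ε : ℝ, 0 < ε → ε < εh →
      ∀ u₁ u₂ : Cholesteric.L2Pair ℂ,
        Cholesteric.IsTwistLocalMin L N α ρ₀ ε M₁ u₁ →
        Cholesteric.IsTwistLocalMin L N α ρ₀ ε M₂ u₂ →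
        ∀ γ : unitInterval → Cholesteric.L2Pair ℂ, Continuous γ →
          (∀ t, γ t ∈ Cholesteric.Admissible α) → γ 0 = u₁ → γ 1 = u₂ →
          ∃ t, γ t ∉ Cholesteric.sublevel L N α ε
            (2 * Real.pi ^ 2 * L * ((N : ℝ) - M₁ - α / (2 * Real.pi)) ^ 2
              + 2 * Real.sqrt 2 / 3 - h) := by
  have hs : (0 : ℝ) < √2 := by positivity
  obtain ⟨η, hη, hηρ, hηh⟩ : ∃ η : ℝ, 0 < η ∧ η < ρ₀ ∧ √2 * η ≤ h / 2 := by
    -- The first entry puts `η` strictly below the modulus of `u₁`; the second limits the loss in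
    -- the well term to `h/2`.
    refine ⟨min (ρ₀ / 2) (h / (2 * √2)), lt_min (half_pos hρ₀.1) (by positivity),
      (min_le_left _ _).trans_lt (half_lt_self hρ₀.1), ?_⟩
    calc √2 * min (ρ₀ / 2) (h / (2 * √2)) ≤ √2 * (h / (2 * √2)) := by
          gcongr; exact min_le_right _ _
      _ = h / 2 := by field_simp
  obtain ⟨εh, hεh, hE⟩ := Cholesteric.exists_lt_energy hL N α (2 * Real.pi * M₁ + α) hη hηh
  refine ⟨εh, hεh, fun ε hε hlt u₁ u₂ hu₁ hu₂ γ hγ hadm hγ0 hγ1 ↦ ?_⟩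
  obtain ⟨hge₁, hl₁⟩ := hu₁.logLift_one hρ₀.1
  obtain ⟨-, hl₂⟩ := hu₂.logLift_one hρ₀.1
  obtain ⟨t, ht1, ht2, ht3⟩ := Cholesteric.exists_norm_prim_eq hγ hadm hη
    (fun x hx ↦ by rw [hγ0]; exact hηρ.trans_le (hge₁ x hx)) (by
      rw [hγ0, hγ1, hl₁, hl₂]
      intro heq
      have h1 := Complex.ofReal_injective (mul_right_cancel₀ Complex.I_ne_zero heq)
      have h2 : (M₂ : ℝ) = M₁ := by
        have : (2 * Real.pi : ℝ) ≠ 0 := by positivity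
        exact mul_left_cancel₀ this (add_right_cancel h1)
      exact hM (Nat.cast_injective h2).symm)
  refine ⟨t, fun hmem ↦ absurd hmem.2 (not_lt.mpr ?_)⟩
  have hbound := hE ε hε hlt (γ t) (hadm t) ht1 ht2 (by rw [ht3, hγ0, hl₁]; simp)
  refine le_of_eq_of_le ?_ hbound
  have hpi := Real.pi_ne_zero
  field_simp
  ring
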